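/- Let $G=(V,E)$ be a finite simple connected undirected graph, let $u\neq v$ be two non-adjacent vertices of $G$, and let $G'=G+e$ be obtained by inserting the edge $e=uv$. Let $\Gamma$ be the set of spanning trees of $G$ and $\Gamma'_e$ the set of spanning trees of $G'$ that contain $e$. Let $R(e)$ be the effective resistance between $u$ and $v$ in $G'$ with unit resistors on the edges, i.e. $R(e)=x_u-x_v$ for any $x\in\mathbb{R}^V$ with $L_{G'}x=\mathbf{1}_u-\mathbf{1}_v$, where $L_{G'}$ is the Laplacian matrix of $G'$. A link-cut operation on $\tau\in\Gamma$ adds $e$ to $\tau$ and then removes an edge other than $e$ from the cycle so created. Let $\mathcal{B}$ be the bipartite graph between $\Gamma$ and $\Gamma'_e$ in which $\tau\in\Gamma$ and $\tau_e\in\Gamma'_e$ are adjacent iff $\tau_e$ arises from $\tau$ by a link-cut operation; $\mathcal{N}_{\mathcal B}(\tau)$ denotes the set of neighbours and $d(\cdot)$ the degree in $\mathcal{B}$, and $U(S)$ is the uniform distribution on a finite non-empty set $S$. Then $\Gamma$, $\Gamma'_e$ and all $\mathcal{N}_{\mathcal B}(\tau)$ ($\tau\in\Gamma$) are non-empty,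 $d(\tau_e)>0$ for all $\tau_e\in\Gamma'_e$, $0<R(e)<1$, and for every real-valued function $f$ of spanning trees of $G'$, $$\mathop{\mathbb{E}}_{\tau\sim U(\Gamma'_e)}[f(\tau)]=\frac{1-R(e)}{R(e)}\mathop{\mathbb{E}}_{\tau\sim U(\Gamma)}\left[\mathop{\mathbb{E}}_{\tau_e\sim U(\mathcal{N}_{\mathcal B}(\tau))}\left[f(\tau_e)\frac{d(\tau)}{d(\tau_e)}\right]\right].$$ That is, for a tree $\tau_e$ generated by drawing $\tau\sim U(\Gamma)$ and then $\tau_e\sim U(\mathcal{N}_{\mathcal B}(\tau))$, the reweighted value $\frac{1-R(e)}{R(e)}\frac{d(\tau)}{d(\tau_e)}f(\tau_e)$ is an unbiased estimate of the mean of $f$ over $U(\Gamma'_e)$. -/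

import Mathlib

open scoped BigOperators Matrix

namespace LinkCut

variable {V : Type*} [Fintype V]

open Classical in
/-- The finite set of all spanning trees of `G`, as subgraphs on the whole vertex set. -/
noncomputable def spanningTrees (G : SimpleGraph V) : Finset (SimpleGraph V) :=
  Finset.univ.filter fun T => T ≤ G ∧ T.IsTree

/-- The graph obtained from `G` by inserting the edge `uv`. -/
def insertEdge (G : SimpleGraph V) (u v : V) : SimpleGraph V := G ⊔ SimpleGraph.edge u v

open Classical in
/-- The spanning trees of the updated graph `G + uv` that contain the edge `uv`. -/
noncomputable def newSpanningTrees (G : SimpleGraph V) (u v : V) : Finset (SimpleGraph V) :=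
  (spanningTrees (insertEdge G u v)).filter fun T => s(u, v) ∈ T.edgeSet

/-- `T'` results from a link-cut operation on `T`: link the edge `uv`, then cut an edge `g`
other than `uv` of the cycle through `uv` created in `T + uv`. -/
def IsLinkCut (u v : V) (T T' : SimpleGraph V) : Prop :=
  ∃ c : (insertEdge T u v).Walk u u, c.IsCycle ∧ s(u, v) ∈ c.edges ∧
    ∃ g ∈ c.edges, g ≠ s(u, v) ∧ T' = (insertEdge T u v).deleteEdges {g}

theorem not_mem_new_of_mem_old {G : SimpleGraph V} {u v : V} (huv : ¬ G.Adj u v)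
    {T : SimpleGraph V} (hT : T ∈ spanningTrees G) : T ∉ newSpanningTrees G u v := by
  classical
  simp only [spanningTrees, newSpanningTrees, Finset.mem_filter, SimpleGraph.mem_edgeSet] at *
  exact fun h => huv (hT.2.1 h.2)

/-- The link-cut graph between the spanning trees of `G` and the spanning trees of `G + uv`
containing `uv`. Simple graphs on `V` outside these two sets are isolated vertices. -/
def linkCutGraph (G : SimpleGraph V) (u v : V) : SimpleGraph (SimpleGraph V) :=
  SimpleGraph.fromRel fun T T' =>
    T ∈ spanningTrees G ∧ T' ∈ newSpanningTrees G u v ∧ IsLinkCut u v T T'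

theorem linkCutGraph_isBipartiteWith {G : SimpleGraph V} {u v : V} (huv : ¬ G.Adj u v) :
    (linkCutGraph G u v).IsBipartiteWith (spanningTrees G : Set (SimpleGraph V))
      (newSpanningTrees G u v : Set (SimpleGraph V)) where
  disjoint := Set.disjoint_left.2 fun _ hT hT' => not_mem_new_of_mem_old huv hT hT'
  mem_of_adj := by
    rintro T T' ⟨-, h | h⟩
    · exact Or.inl ⟨h.1, h.2.1⟩
    · exact Or.inr ⟨h.2.1, h.1⟩

open Classical in
/-- The set of neighbours of `T` in the link-cut graph. -/
noncomputable def linkCutNeighbors (G : SimpleGraph V) (u v : V) (T : SimpleGraph V) :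
    Finset (SimpleGraph V) :=
  (linkCutGraph G u v).neighborFinset T

open Classical in
/-- The degree of `T` in the link-cut graph. -/
noncomputable def linkCutDegree (G : SimpleGraph V) (u v : V) (T : SimpleGraph V) : ℕ :=
  (linkCutGraph G u v).degree T

open Classical in
/-- `x` is a vector of potentials for a unit current entering at `u` and leaving at `v`, every
edge of `G` being a unit resistor. -/
def IsUnitPotential (G : SimpleGraph V) (u v : V) (x : V → ℝ) : Prop :=
  G.lapMatrix ℝ *ᵥ x = Pi.single u 1 - Pi.single v 1

open Classical in
/-- Effective resistance: the potential difference between `u` and `v` when a unit current enters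
at `u` and leaves at `v`. -/
noncomputable def effectiveResistance (G : SimpleGraph V) (u v : V) : ℝ :=
  if h : ∃ x, IsUnitPotential G u v x then h.choose u - h.choose v else 0

theorem exists_isUnitPotential {G : SimpleGraph V} (hG : G.Connected) (u v : V) :
    ∃ x, IsUnitPotential G u v x := by
  classical
  let A : Module.End ℝ (EuclideanSpace ℝ V) := Matrix.toEuclideanLin (G.lapMatrix ℝ)
  have hA : A.IsSymmetric := Matrix.isSymmetric_toEuclideanLin_iff.2 (G.isHermitian_lapMatrix ℝ)
  let b : EuclideanSpace ℝ V := WithLp.toLp 2 (Pi.single u 1 - Pi.single v 1)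
  have hb : b ∈ LinearMap.range A := by
    rw [← Submodule.orthogonal_orthogonal (LinearMap.range A), hA.orthogonal_range]
    rw [Submodule.mem_orthogonal]
    intro y hy
    have hy' : G.lapMatrix ℝ *ᵥ (WithLp.ofLp y) = 0 := congrArg WithLp.ofLp hy
    have := (G.lapMatrix_mulVec_eq_zero_iff_forall_reachable).1 hy' u v (hG.preconnected u v)
    simp [b, PiLp.inner_apply, sub_mul, Finset.sum_sub_distrib, this]
  obtain ⟨x, hx⟩ := hb
  exact ⟨WithLp.ofLp x, congrArg WithLp.ofLp hx⟩

/-- In a connected graph the effective resistance does not depend on the chosen potentials. -/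
theorem effectiveResistance_eq {G : SimpleGraph V} (hG : G.Connected) {u v : V} {x : V → ℝ}
    (hx : IsUnitPotential G u v x) : effectiveResistance G u v = x u - x v := by
  classical
  have h : ∃ x, IsUnitPotential G u v x := ⟨x, hx⟩
  have hc := h.choose_spec
  have h0 : G.lapMatrix ℝ *ᵥ (h.choose - x) = 0 := by
    unfold IsUnitPotential at hx hc
    rw [Matrix.mulVec_sub, sub_eq_zero]
    exact hc.trans hx.symm
  have := (G.lapMatrix_mulVec_eq_zero_iff_forall_reachable).1 h0 u v (hG.preconnected u v)
  simp only [Pi.sub_apply] at this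
  rw [effectiveResistance, dif_pos h]
  linarith

end LinkCut

/-! In the weighted double average, $d(\tau)$ cancels the size of the inner index set. Interchanging
the sums then counts each $\tau_e$ exactly $d(\tau_e)$ times, so what remains is
$|\Gamma|^{-1}\sum_{\Gamma'_e} f$ (`sum_sum_linkCutNeighbors`). The prefactor must therefore be
$|\Gamma|/|\Gamma'_e|$, that is, $R(e)=|\Gamma'_e|/(|\Gamma|+|\Gamma'_e|)$.

This is Kirchhoff's formula (`isUnitPotential_forests`, `effectiveResistance_eq_card_div`). Each
spanning tree carries a unit flow from $u$ to $v$ along its tree path. The average of these flows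
over all trees satisfies the node law, and it is the gradient of a potential that counts
two-component forests. -/

namespace LinkCut

open SimpleGraph

/-! ### Two-component forests and edge exchange in trees -/

section Forests

variable {V : Type*} {F G T : SimpleGraph V} {a b u v w y z : V}

/-- `F` is a forest with exactly two components, one containing `a`, the other containing `b`. -/
structure IsSeparatingForest (F : SimpleGraph V) (a b : V) : Prop where
  isAcyclic : F.IsAcyclic
  not_reachable : ¬ F.Reachable a b
  reachable_or (z : V) : F.Reachable a z ∨ F.Reachable b z

namespace IsSeparatingForest

theorem of_not_reachable (h : IsSeparatingForest F a b) (huv : ¬ F.Reachable u v) :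
    IsSeparatingForest F u v := by
  refine ⟨h.isAcyclic, huv, fun z => ?_⟩
  rcases h.reachable_or u with hu | hu <;> rcases h.reachable_or v with hv | hv <;>
    rcases h.reachable_or z with hz | hz
  · exact Or.inl (hu.symm.trans hz)
  · exact absurd (hu.symm.trans hv) huv
  · exact Or.inl (hu.symm.trans hz)
  · exact Or.inr (hv.symm.trans hz)
  · exact Or.inr (hv.symm.trans hz)
  · exact Or.inl (hu.symm.trans hz)
  · exact absurd (hu.symm.trans hv) huv
  · exact Or.inl (hu.symm.trans hz)

theorem symm (h : IsSeparatingForest F a b) : IsSeparatingForest F b a :=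
  h.of_not_reachable fun hba => h.not_reachable hba.symm

theorem reachable_right_iff (h : IsSeparatingForest F a b) (z : V) :
    F.Reachable b z ↔ ¬ F.Reachable a z :=
  ⟨fun hb ha => h.not_reachable (ha.trans hb.symm), (h.reachable_or z).resolve_left⟩

theorem transfer (h : IsSeparatingForest F a b) (hu : F.Reachable a u) (hv : F.Reachable b v) :
    IsSeparatingForest F u v :=
  h.of_not_reachable fun huv => h.not_reachable (hu.trans (huv.trans hv.symm))

theorem ne (h : IsSeparatingForest F a b) : a ≠ b := by
  rintro rfl
  exact h.not_reachable (Reachable.refl _)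

theorem not_adj (h : IsSeparatingForest F a b) : ¬ F.Adj a b := fun hab =>
  h.not_reachable hab.reachable

theorem adj_sup_edge (h : IsSeparatingForest F a b) : (F ⊔ edge a b).Adj a b :=
  Or.inr ((edge_adj ..).2 ⟨Or.inl ⟨rfl, rfl⟩, h.ne⟩)

theorem isTree_sup_edge (h : IsSeparatingForest F a b) : (F ⊔ edge a b).IsTree := by
  refine ⟨?_, IsAcyclic.sup_edge_of_not_reachable h.not_reachable h.isAcyclic⟩
  refine (connected_iff_exists_forall_reachable _).2 ⟨a, fun z => ?_⟩
  rcases h.reachable_or z with hz | hz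
  · exact hz.mono le_sup_left
  · exact h.adj_sup_edge.reachable.trans (hz.mono le_sup_left)

theorem deleteEdges_sup_edge (h : IsSeparatingForest F a b) :
    (F ⊔ edge a b).deleteEdges {s(a, b)} = F := by
  rw [deleteEdges_sup, deleteEdges_edge (Set.mem_singleton _), sup_bot_eq, deleteEdges_eq_self]
  simpa using h.not_adj

end IsSeparatingForest

theorem reachable_deleteEdges_or (h : T.Reachable w z) (y : V) :
    (T.deleteEdges {s(w, y)}).Reachable w z ∨ (T.deleteEdges {s(w, y)}).Reachable y z := by
  -- The walk runs from `z` to `w`, so that the induction moves its start and keeps `w` fixed.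
  obtain ⟨p⟩ := h.symm
  induction p with
  | nil => exact Or.inl (Reachable.refl _)
  | @cons c d w hcd p ih =>
    have ih := ih p.reverse.reachable
    by_cases hc : s(c, d) = s(w, y)
    · rcases Sym2.eq_iff.1 hc with ⟨rfl, rfl⟩ | ⟨rfl, rfl⟩
      · exact Or.inl (Reachable.refl _)
      · exact Or.inr (Reachable.refl _)
    · have hcd' : (T.deleteEdges {s(w, y)}).Adj c d := deleteEdges_adj.2 ⟨hcd, hc⟩
      have hdc := hcd'.symm.reachable
      exact ih.imp (·.trans hdc) (·.trans hdc)

theorem isSeparatingForest_deleteEdges (hT : T.IsTree) (hwy : T.Adj w y) :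
    IsSeparatingForest (T.deleteEdges {s(w, y)}) w y where
  isAcyclic := hT.isAcyclic.anti (deleteEdges_le _)
  not_reachable := isAcyclic_iff_forall_adj_isBridge.1 hT.isAcyclic hwy
  reachable_or z := reachable_deleteEdges_or (hT.1.preconnected w z) y

theorem deleteEdges_sup_edge_of_adj (h : T.Adj w y) :
    T.deleteEdges {s(w, y)} ⊔ edge w y = T := by
  rw [edge, deleteEdges]
  exact sdiff_sup_cancel ((edge_le_iff _).2 (Or.inr h))

/-- In a tree, exactly one edge at `w` separates `w` from a given other vertex `z`. -/
theorem existsUnique_adj_not_reachable (hT : T.IsTree) (hwz : w ≠ z) :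
    ∃! y, T.Adj w y ∧ ¬ (T.deleteEdges {s(w, y)}).Reachable w z := by
  obtain ⟨p, hp⟩ := hT.1.exists_isPath w z
  cases p with
  | nil => exact absurd rfl hwz
  | @cons _ y _ hwy p =>
    have hw : w ∉ p.support := ((Walk.cons_isPath_iff _ _).1 hp).2
    -- After its first step the path never returns to `w`, so its tail survives the deletion of any
    -- edge at `w`.
    have key (x : V) : (T.deleteEdges {s(w, x)}).Reachable y z :=
      ⟨p.toDeleteEdges _ fun e he h => hw (by
        rw [Set.mem_singleton_iff] at h
        subst h
        exact p.fst_mem_support_of_mem_edges he)⟩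
    refine ⟨y, ⟨hwy, ?_⟩, fun x ⟨hwx, hx⟩ => ?_⟩
    · rw [← (isSeparatingForest_deleteEdges hT hwy).reachable_right_iff]
      exact key y
    · by_contra hne
      refine hx (Reachable.trans (Adj.reachable ?_) (key x))
      refine deleteEdges_adj.2 ⟨hwy, fun h => hne ?_⟩
      exact (Sym2.congr_right.1 h).symm

theorem insertEdge_adj_self (hne : u ≠ v) :
    (insertEdge G u v).Adj u v :=
  Or.inr ((edge_adj ..).2 ⟨Or.inl ⟨rfl, rfl⟩, hne⟩)

theorem le_of_le_insertEdge (h : T ≤ insertEdge G u v)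
    (huv : ¬ T.Adj u v) : T ≤ G := by
  intro a b hab
  rcases h hab with h | h
  · exact h
  · rcases ((edge_adj ..).1 h).1 with ⟨rfl, rfl⟩ | ⟨rfl, rfl⟩
    · exact absurd hab huv
    · exact absurd hab.symm huv

/-- Replacing a tree edge that separates `u` from `v` by `uv` is a link-cut operation. -/
theorem isLinkCut_of_not_reachable (hT : T.IsTree) (huv : ¬ T.Adj u v)
    (hwy : T.Adj w y) (h : ¬ (T.deleteEdges {s(w, y)}).Reachable u v) :
    IsLinkCut u v T (T.deleteEdges {s(w, y)} ⊔ edge u v) := by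
  have hne : u ≠ v := by
    rintro rfl
    exact h (Reachable.refl _)
  obtain ⟨p, hp⟩ := hT.1.exists_isPath v u
  -- The cycle is `uv` followed by the tree path back from `v` to `u`, which must use every
  -- separating edge.
  have hmem : s(w, y) ∈ p.edges :=
    p.mem_edges_of_not_reachable_deleteEdges fun h' => h h'.symm
  have hle : T ≤ insertEdge T u v := le_sup_left
  have hg : s(w, y) ≠ s(u, v) := fun hg => huv ((mem_edgeSet T).1 (hg ▸ hwy))
  refine ⟨Walk.cons (insertEdge_adj_self hne) (p.mapLe hle), ?_, by simp, s(w, y), ?_, hg, ?_⟩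
  · rw [Walk.cons_isCycle_iff, Walk.edges_mapLe_eq_edges]
    exact ⟨hp.mapLe hle, fun hmem => huv (p.edges_subset_edgeSet hmem)⟩
  · rw [Walk.edges_cons, Walk.edges_mapLe_eq_edges]
    exact List.mem_cons_of_mem _ hmem
  · rw [insertEdge, deleteEdges_sup]
    congr 1
    rw [eq_comm, deleteEdges_eq_self, edgeSet_edge_of_ne hne]
    simpa using hg.symm

end Forests

/-! ### Kirchhoff's formula and double counting of link-cut pairs -/

section Counting

variable {V : Type*} [Fintype V]

theorem mem_spanningTrees {G T : SimpleGraph V} : T ∈ spanningTrees G ↔ T ≤ G ∧ T.IsTree := by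
  simp [spanningTrees]

theorem mem_newSpanningTrees {G T : SimpleGraph V} {u v : V} :
    T ∈ newSpanningTrees G u v ↔ (T ≤ insertEdge G u v ∧ T.IsTree) ∧ T.Adj u v := by
  simp [newSpanningTrees, mem_spanningTrees]

open Classical in
/-- The forests in `H` with exactly two components, one containing `a`, the other `b`. -/
noncomputable def separatingForests (H : SimpleGraph V) (a b : V) : Finset (SimpleGraph V) :=
  Finset.univ.filter fun F => F ≤ H ∧ IsSeparatingForest F a b

theorem mem_separatingForests {H F : SimpleGraph V} {a b : V} :
    F ∈ separatingForests H a b ↔ F ≤ H ∧ IsSeparatingForest F a b := by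
  simp [separatingForests]

open Classical in
/-- The indicator of `b` lying in the component of `a`. -/
noncomputable def sameComponent (F : SimpleGraph V) (a b : V) : ℝ :=
  if F.Reachable a b then 1 else 0

theorem sameComponent_of_reachable {F : SimpleGraph V} {a b : V} (h : F.Reachable a b) :
    sameComponent F a b = 1 := if_pos h

theorem sameComponent_of_not_reachable {F : SimpleGraph V} {a b : V} (h : ¬ F.Reachable a b) :
    sameComponent F a b = 0 := if_neg h

/-- Reciprocity, forest by forest: a nonzero term on either side forces the forest to separate both
pairs, and both sides then give `1` if `w` lies with `u` and `-1` if `y` does. -/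
theorem sum_separatingForests_exchange (H : SimpleGraph V) (u v w y : V) :
    ∑ F ∈ separatingForests H u v, (sameComponent F u w - sameComponent F u y) =
      ∑ F ∈ separatingForests H w y, (sameComponent F w u - sameComponent F w v) := by
  classical
  have key (F : SimpleGraph V) :
      (if IsSeparatingForest F u v then sameComponent F u w - sameComponent F u y else 0) =
        if IsSeparatingForest F w y then sameComponent F w u - sameComponent F w v else 0 := by
    by_cases huv : IsSeparatingForest F u v
    · rw [if_pos huv]
      by_cases hw : F.Reachable u w <;> by_cases hy : F.Reachable u y
      · rw [if_neg fun h => h.not_reachable (hw.symm.trans hy), sameComponent_of_reachable hw,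
          sameComponent_of_reachable hy, sub_self]
      · have hwy := huv.transfer hw ((huv.reachable_right_iff y).2 hy)
        rw [if_pos hwy, sameComponent_of_reachable hw, sameComponent_of_not_reachable hy,
          sameComponent_of_reachable hw.symm, sameComponent_of_not_reachable
            fun h => huv.not_reachable (hw.trans h)]
      · have hvw := (huv.reachable_right_iff w).2 hw
        have hwy := (huv.transfer hy hvw).symm
        rw [if_pos hwy, sameComponent_of_reachable hy, sameComponent_of_not_reachable hw,
          sameComponent_of_reachable hvw.symm, sameComponent_of_not_reachable
            fun h => hw h.symm]
      · have hvw := (huv.reachable_right_iff w).2 hw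
        have hvy := (huv.reachable_right_iff y).2 hy
        rw [if_neg fun h => h.not_reachable (hvw.symm.trans hvy),
          sameComponent_of_not_reachable hw, sameComponent_of_not_reachable hy, sub_self]
    · rw [if_neg huv]
      by_cases hwy : IsSeparatingForest F w y
      · rw [if_pos hwy]
        have hr : F.Reachable u v := by
          by_contra h
          exact huv (hwy.of_not_reachable h)
        by_cases hu : F.Reachable w u
        · rw [sameComponent_of_reachable hu, sameComponent_of_reachable (hu.trans hr), sub_self]
        · rw [sameComponent_of_not_reachable hu, sameComponent_of_not_reachable
            fun h => hu (h.trans hr.symm), sub_self]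
      · rw [if_neg hwy]
  unfold separatingForests
  simp_rw [← Finset.filter_filter]
  rw [Finset.sum_filter (p := fun F => IsSeparatingForest F u v),
    Finset.sum_filter (p := fun F => IsSeparatingForest F w y)]
  exact Finset.sum_congr rfl fun F _ => key F

open Classical in
theorem sum_separatingForests_eq {M : Type*} [AddCommMonoid M] {H : SimpleGraph V} {w y : V}
    (hwy : H.Adj w y) (g : SimpleGraph V → M) :
    ∑ F ∈ separatingForests H w y, g F =
      ∑ T ∈ (spanningTrees H).filter fun T => T.Adj w y, g (T.deleteEdges {s(w, y)}) := by
  refine Finset.sum_nbij' (fun F => F ⊔ edge w y) (fun T => T.deleteEdges {s(w, y)}) ?_ ?_ ?_ ?_ ?_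
  · intro F hF
    obtain ⟨hle, hF⟩ := mem_separatingForests.1 hF
    exact Finset.mem_filter.2 ⟨mem_spanningTrees.2
      ⟨sup_le hle ((edge_le_iff _).2 (Or.inr hwy)), hF.isTree_sup_edge⟩, hF.adj_sup_edge⟩
  · intro T hT
    obtain ⟨hT, hadj⟩ := Finset.mem_filter.1 hT
    obtain ⟨hle, hT⟩ := mem_spanningTrees.1 hT
    exact mem_separatingForests.2
      ⟨(deleteEdges_le _).trans hle, isSeparatingForest_deleteEdges hT hadj⟩
  · exact fun F hF => (mem_separatingForests.1 hF).2.deleteEdges_sup_edge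
  · exact fun T hT => deleteEdges_sup_edge_of_adj (Finset.mem_filter.1 hT).2
  · intro F hF
    rw [(mem_separatingForests.1 hF).2.deleteEdges_sup_edge]

open Classical in
-- Only the first edge of the tree path from `w` to `z` contributes.
theorem sum_adj_one_sub_sameComponent {T : SimpleGraph V} (hT : T.IsTree) (w z : V) :
    (∑ y, if T.Adj w y then 1 - sameComponent (T.deleteEdges {s(w, y)}) w z else 0) =
      if w = z then 0 else 1 := by
  split_ifs with hwz
  · subst hwz
    exact Finset.sum_eq_zero fun y _ => by
      rw [sameComponent_of_reachable (Reachable.refl _), sub_self, ite_self]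
  · obtain ⟨y, ⟨hwy, hy⟩, huniq⟩ := existsUnique_adj_not_reachable hT hwz
    rw [Finset.sum_eq_single y]
    · rw [if_pos hwy, sameComponent_of_not_reachable hy, sub_zero]
    · intro x _ hxy
      by_cases hwx : T.Adj w x
      · have hx : (T.deleteEdges {s(w, x)}).Reachable w z := by
          by_contra h
          exact hxy (huniq x ⟨hwx, h⟩)
        rw [if_pos hwx, sameComponent_of_reachable hx, sub_self]
      · rw [if_neg hwx]
    · exact fun h => absurd (Finset.mem_univ y) h

open Classical in
/-- The net flow out of `w` of the unit flow from `u` to `v` along the edges of a tree. -/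
theorem sum_adj_sameComponent_sub {T : SimpleGraph V} (hT : T.IsTree) (u v w : V) :
    (∑ y, if T.Adj w y then sameComponent (T.deleteEdges {s(w, y)}) w u -
        sameComponent (T.deleteEdges {s(w, y)}) w v else 0) =
      (Pi.single u 1 - Pi.single v 1 : V → ℝ) w := by
  have h : (Pi.single u 1 - Pi.single v 1 : V → ℝ) w =
      (if w = v then 0 else 1) - if w = u then 0 else 1 := by
    rw [Pi.sub_apply, Pi.single_apply, Pi.single_apply]
    split_ifs <;> norm_num
  rw [h, ← sum_adj_one_sub_sameComponent hT w v, ← sum_adj_one_sub_sameComponent hT w u,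
    ← Finset.sum_sub_distrib]
  refine Finset.sum_congr rfl fun y _ => ?_
  split_ifs <;> ring

theorem spanningTrees_nonempty {H : SimpleGraph V} (hH : H.Connected) :
    (spanningTrees H).Nonempty := by
  obtain ⟨T, hT⟩ := hH.exists_isTree_le
  exact ⟨T, mem_spanningTrees.2 hT⟩

/-- Kirchhoff's formula for the potentials of a unit current: the potential at `w` is the number
of two-component forests separating `v` from `u` and `w`, over the number of spanning trees. -/
theorem isUnitPotential_forests {H : SimpleGraph V} (hH : H.Connected) (u v : V) :
    IsUnitPotential H u v fun w =>
      (∑ F ∈ separatingForests H u v, sameComponent F u w) / (spanningTrees H).card := by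
  classical
  have hN : ((spanningTrees H).card : ℝ) ≠ 0 :=
    Nat.cast_ne_zero.2 (Finset.card_ne_zero.2 (spanningTrees_nonempty hH))
  unfold IsUnitPotential
  funext w
  rw [lapMatrix_mulVec_apply, ← card_neighborFinset_eq_degree, ← nsmul_eq_mul,
    ← Finset.sum_const, ← Finset.sum_sub_distrib]
  -- The potential drop along `wy` is the average over spanning trees of the tree flow through `wy`:
  -- reciprocity moves the sum to forests separating `w` from `y`, and adding `wy` turns these into
  -- trees.
  have hy (y : V) (hy : y ∈ H.neighborFinset w) :
      (∑ F ∈ separatingForests H u v, sameComponent F u w) / ((spanningTrees H).card : ℝ) -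
        (∑ F ∈ separatingForests H u v, sameComponent F u y) / (spanningTrees H).card =
      (∑ T ∈ spanningTrees H, if T.Adj w y then sameComponent (T.deleteEdges {s(w, y)}) w u -
        sameComponent (T.deleteEdges {s(w, y)}) w v else 0) / (spanningTrees H).card := by
    rw [← sub_div, ← Finset.sum_sub_distrib, sum_separatingForests_exchange,
      sum_separatingForests_eq ((mem_neighborFinset ..).1 hy), Finset.sum_filter]
  rw [Finset.sum_congr rfl hy, ← Finset.sum_div, Finset.sum_comm, div_eq_iff hN, mul_comm,
    ← nsmul_eq_mul, ← Finset.sum_const]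
  refine Finset.sum_congr rfl fun T hT => ?_
  obtain ⟨hle, hT⟩ := mem_spanningTrees.1 hT
  rw [← sum_adj_sameComponent_sub hT u v w]
  refine Finset.sum_subset (Finset.subset_univ _) fun y _ hy => if_neg fun hwy => hy ?_
  exact (mem_neighborFinset ..).2 (hle hwy)

theorem effectiveResistance_eq_card_div {H : SimpleGraph V} (hH : H.Connected) (u v : V) :
    effectiveResistance H u v =
      ((separatingForests H u v).card : ℝ) / (spanningTrees H).card := by
  rw [effectiveResistance_eq hH (isUnitPotential_forests hH u v), ← sub_div,
    ← Finset.sum_sub_distrib, Finset.card_eq_sum_ones (separatingForests H u v), Nat.cast_sum]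
  refine congrArg (· / ((spanningTrees H).card : ℝ)) ?_
  refine Finset.sum_congr rfl fun F hF => ?_
  -- The potential at `u` counts every separating forest, the one at `v` none.
  rw [sameComponent_of_reachable (Reachable.refl _),
    sameComponent_of_not_reachable (mem_separatingForests.1 hF).2.not_reachable]
  norm_num

theorem card_newSpanningTrees (G : SimpleGraph V) {u v : V} (hne : u ≠ v) :
    (newSpanningTrees G u v).card = (separatingForests (insertEdge G u v) u v).card := by
  classical
  rw [Finset.card_eq_sum_ones, Finset.card_eq_sum_ones,
    sum_separatingForests_eq (insertEdge_adj_self hne)]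
  refine Finset.sum_congr ?_ fun _ _ => rfl
  ext T
  rw [mem_newSpanningTrees, Finset.mem_filter, mem_spanningTrees]

theorem card_spanningTrees_insertEdge {G : SimpleGraph V} {u v : V} (huv : ¬ G.Adj u v) :
    (spanningTrees (insertEdge G u v)).card =
      (newSpanningTrees G u v).card + (spanningTrees G).card := by
  classical
  rw [← Finset.card_filter_add_card_filter_not (s := spanningTrees (insertEdge G u v))
    fun T => T.Adj u v]
  congr 2
  ext T
  rw [Finset.mem_filter, mem_spanningTrees, mem_spanningTrees]
  constructor
  · exact fun ⟨⟨hle, hT⟩, h⟩ => ⟨le_of_le_insertEdge hle h, hT⟩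
  · exact fun ⟨hle, hT⟩ => ⟨⟨hle.trans le_sup_left, hT⟩, fun h => huv (hle h)⟩

theorem linkCutDegree_eq_card (G : SimpleGraph V) (u v : V) (T : SimpleGraph V) :
    linkCutDegree G u v T = (linkCutNeighbors G u v T).card := rfl

theorem mem_linkCutNeighbors {G : SimpleGraph V} {u v : V} {T T' : SimpleGraph V} :
    T' ∈ linkCutNeighbors G u v T ↔ (linkCutGraph G u v).Adj T T' := by
  simp [linkCutNeighbors]

theorem linkCutGraph_adj {G : SimpleGraph V} {u v : V} (huv : ¬ G.Adj u v)
    {T T' : SimpleGraph V} (hT : T ∈ spanningTrees G) (hT' : T' ∈ newSpanningTrees G u v)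
    (h : IsLinkCut u v T T') : (linkCutGraph G u v).Adj T T' := by
  refine (fromRel_adj ..).2 ⟨?_, Or.inl ⟨hT, hT', h⟩⟩
  rintro rfl
  exact not_mem_new_of_mem_old huv hT hT'

theorem exists_linkCut_of_mem_spanningTrees {G : SimpleGraph V} {u v : V} (hne : u ≠ v)
    (huv : ¬ G.Adj u v) {T : SimpleGraph V} (hT : T ∈ spanningTrees G) :
    ∃ T' ∈ newSpanningTrees G u v, (linkCutGraph G u v).Adj T T' := by
  obtain ⟨hle, hTree⟩ := mem_spanningTrees.1 hT
  obtain ⟨y, ⟨hy, hr⟩, -⟩ := existsUnique_adj_not_reachable hTree hne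
  have hF := (isSeparatingForest_deleteEdges hTree hy).of_not_reachable hr
  have hmem : T.deleteEdges {s(u, y)} ⊔ edge u v ∈ newSpanningTrees G u v :=
    mem_newSpanningTrees.2 ⟨⟨sup_le_sup_right ((deleteEdges_le _).trans hle) _,
      hF.isTree_sup_edge⟩, hF.adj_sup_edge⟩
  exact ⟨_, hmem, linkCutGraph_adj huv hT hmem
    (isLinkCut_of_not_reachable hTree (fun h => huv (hle h)) hy hr)⟩

theorem exists_linkCut_of_mem_newSpanningTrees {G : SimpleGraph V} (hG : G.Connected) {u v : V}
    (huv : ¬ G.Adj u v) {T' : SimpleGraph V} (hT' : T' ∈ newSpanningTrees G u v) :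
    ∃ T ∈ spanningTrees G, (linkCutGraph G u v).Adj T T' := by
  obtain ⟨⟨hle, hTree⟩, hadj⟩ := mem_newSpanningTrees.1 hT'
  have hF := isSeparatingForest_deleteEdges hTree hadj
  set F := T'.deleteEdges {s(u, v)} with hFdef
  have hFG : F ≤ G := le_of_le_insertEdge ((deleteEdges_le _).trans hle) hF.not_adj
  obtain ⟨p⟩ := hG.preconnected u v
  -- A walk in `G` from `u` to `v` must leave the component of `u` in `F`; the edge where it does so
  -- completes `F` to a spanning tree of `G`.
  obtain ⟨⟨⟨w, y⟩, hwy⟩, -, hw, hy⟩ :=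
    p.exists_boundary_dart {z | F.Reachable u z} (Reachable.refl _) hF.not_reachable
  have hF' := hF.transfer hw ((hF.reachable_right_iff y).2 hy)
  have hTG : F ⊔ edge w y ≤ G := sup_le hFG ((edge_le_iff _).2 (Or.inr hwy))
  have hmem : F ⊔ edge w y ∈ spanningTrees G := mem_spanningTrees.2 ⟨hTG, hF'.isTree_sup_edge⟩
  have hlc := isLinkCut_of_not_reachable (u := u) (v := v) hF'.isTree_sup_edge
    (fun h => huv (hTG h)) hF'.adj_sup_edge (by
      rw [hF'.deleteEdges_sup_edge]
      exact hF.not_reachable)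
  rw [hF'.deleteEdges_sup_edge, hFdef, deleteEdges_sup_edge_of_adj hadj] at hlc
  exact ⟨_, hmem, linkCutGraph_adj huv hmem hT' hlc⟩

theorem sum_sum_linkCutNeighbors {G : SimpleGraph V} (hG : G.Connected) {u v : V}
    (huv : ¬ G.Adj u v) (f : SimpleGraph V → ℝ) :
    ∑ T ∈ spanningTrees G, ∑ T' ∈ linkCutNeighbors G u v T, f T' / linkCutDegree G u v T' =
      ∑ T' ∈ newSpanningTrees G u v, f T' := by
  have hbip := linkCutGraph_isBipartiteWith huv
  rw [Finset.sum_comm' (t' := newSpanningTrees G u v) (s' := linkCutNeighbors G u v)]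
  · refine Finset.sum_congr rfl fun T' hT' => ?_
    obtain ⟨T, -, hT⟩ := exists_linkCut_of_mem_newSpanningTrees hG huv hT'
    -- A tree of degree zero would drop out of the double sum and bias the estimate.
    have hd : (linkCutDegree G u v T' : ℝ) ≠ 0 := by
      rw [linkCutDegree_eq_card]
      exact Nat.cast_ne_zero.2 (Finset.card_ne_zero_of_mem (mem_linkCutNeighbors.2 hT.symm))
    rw [Finset.sum_const, nsmul_eq_mul, ← linkCutDegree_eq_card, mul_div_cancel₀ _ hd]
  · intro T T'
    rw [mem_linkCutNeighbors, mem_linkCutNeighbors, adj_comm _ T' T]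
    constructor
    · exact fun ⟨hT, h⟩ => ⟨h, hbip.mem_of_mem_adj hT h⟩
    · exact fun ⟨h, hT'⟩ => ⟨hbip.symm.mem_of_mem_adj hT' h.symm, h⟩

end Counting

end LinkCut

theorem mainTheorem7 {V : Type*} [Fintype V] (G : SimpleGraph V) (hG : G.Connected)
    (u v : V) (hne : u ≠ v) (huv : ¬ G.Adj u v) (f : SimpleGraph V → ℝ) :
    (LinkCut.spanningTrees G).Nonempty ∧
    (LinkCut.newSpanningTrees G u v).Nonempty ∧
    (∀ T ∈ LinkCut.spanningTrees G, (LinkCut.linkCutNeighbors G u v T).Nonempty) ∧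
    (∀ T ∈ LinkCut.newSpanningTrees G u v, 0 < LinkCut.linkCutDegree G u v T) ∧
    0 < LinkCut.effectiveResistance (LinkCut.insertEdge G u v) u v ∧
    LinkCut.effectiveResistance (LinkCut.insertEdge G u v) u v < 1 ∧
    (𝔼 T ∈ LinkCut.newSpanningTrees G u v, f T) =
      (1 - LinkCut.effectiveResistance (LinkCut.insertEdge G u v) u v) /
          LinkCut.effectiveResistance (LinkCut.insertEdge G u v) u v *
        𝔼 T ∈ LinkCut.spanningTrees G,
          𝔼 T' ∈ LinkCut.linkCutNeighbors G u v T,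
            f T' * ((LinkCut.linkCutDegree G u v T : ℝ) /
              (LinkCut.linkCutDegree G u v T' : ℝ)) := by
  have hold := LinkCut.spanningTrees_nonempty hG
  have hnbr (T : SimpleGraph V) (hT : T ∈ LinkCut.spanningTrees G) :
      (LinkCut.linkCutNeighbors G u v T).Nonempty := by
    obtain ⟨T', -, h⟩ := LinkCut.exists_linkCut_of_mem_spanningTrees hne huv hT
    exact ⟨T', LinkCut.mem_linkCutNeighbors.2 h⟩
  have hnew : (LinkCut.newSpanningTrees G u v).Nonempty := by
    obtain ⟨T, hT⟩ := hold
    obtain ⟨T', hT', -⟩ := LinkCut.exists_linkCut_of_mem_spanningTrees hne huv hT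
    exact ⟨T', hT'⟩
  have hn : (0 : ℝ) < (LinkCut.newSpanningTrees G u v).card := Nat.cast_pos.2 hnew.card_pos
  have ho : (0 : ℝ) < (LinkCut.spanningTrees G).card := Nat.cast_pos.2 hold.card_pos
  have hR : LinkCut.effectiveResistance (LinkCut.insertEdge G u v) u v =
      (LinkCut.newSpanningTrees G u v).card /
        ((LinkCut.newSpanningTrees G u v).card + (LinkCut.spanningTrees G).card) := by
    have hconn : (LinkCut.insertEdge G u v).Connected := hG.mono le_sup_left
    rw [LinkCut.effectiveResistance_eq_card_div hconn, ← LinkCut.card_newSpanningTrees G hne,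
      LinkCut.card_spanningTrees_insertEdge huv, Nat.cast_add]
  refine ⟨hold, hnew, hnbr, fun T' hT' => ?_, ?_, ?_, ?_⟩
  · obtain ⟨T, -, h⟩ := LinkCut.exists_linkCut_of_mem_newSpanningTrees hG huv hT'
    exact Finset.card_pos.2 ⟨T, LinkCut.mem_linkCutNeighbors.2 h.symm⟩
  · rw [hR]
    positivity
  · rw [hR, div_lt_one (by positivity)]
    linarith
  · have hinner : (𝔼 T ∈ LinkCut.spanningTrees G, 𝔼 T' ∈ LinkCut.linkCutNeighbors G u v T,
        f T' * ((LinkCut.linkCutDegree G u v T : ℝ) / LinkCut.linkCutDegree G u v T')) =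
        𝔼 T ∈ LinkCut.spanningTrees G,
          ∑ T' ∈ LinkCut.linkCutNeighbors G u v T, f T' / LinkCut.linkCutDegree G u v T' := by
      refine Finset.expect_congr rfl fun T hT => ?_
      have hd : (LinkCut.linkCutDegree G u v T : ℝ) ≠ 0 :=
        Nat.cast_ne_zero.2 (Finset.card_ne_zero.2 (hnbr T hT))
      rw [Finset.expect_eq_sum_div_card, ← LinkCut.linkCutDegree_eq_card, div_eq_iff hd,
        Finset.sum_mul]
      exact Finset.sum_congr rfl fun T' _ => by ring
    rw [hinner, Finset.expect_eq_sum_div_card, Finset.expect_eq_sum_div_card,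
      LinkCut.sum_sum_linkCutNeighbors hG huv, hR]
    -- With $R(e)$ as this ratio, $(1-R(e))/R(e)$ is $|\Gamma|/|\Gamma'_e|$.
    field_simp
    ring
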